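/- Let $n\ge 0$ and let $\mathcal X_0,\dots,\mathcal X_n$ and $\mathcal Y_0,\dots,\mathcal Y_n$ be Polish spaces with their Borel $\sigma$-algebras. Write $\mathcal X_{0,i}=\prod_{j\le i}\mathcal X_j$, $x^i=(x_0,\dots,x_i)$, and similarly for $\mathcal Y$; $y^{-1}$ is the empty sequence. Let $P_{X^n}$ be a Borel probability measure on $\mathcal X_{0,n}$, let $\rho_{0,i}:\mathcal X_{0,i}\times\mathcal Y_{0,i}\to[0,\infty]$ $(0\le i\le n)$ be measurable, and put $d_{0,n}(x^n,y^n)=\sum_{i=0}^n\rho_{0,i}(x^i,y^i)$. For $D\in[0,\infty)$ let $\overrightarrow Q_{0,n}(D)$ be the set of all stochastic kernels $P_{Y^n|X^n}$ from $\mathcal X_{0,n}$ to $\mathcal Y_{0,n}$ such that (i) (realizability) there are stochastic kernels $P_{Y_i|Y^{i-1},X^i}(dy_i|y^{i-1},x^i)$, $0\le i\le n$, with $P_{Y^n|X^n}(dy^n|x^n)=\bigotimes_{i=0}^nP_{Y_i|Y^{i-1},X^i}(dy_i|y^{i-1},x^i)$ for $P_{X^n}$-almost every $x^n$; (ii) (fidelity)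 $\int d_{0,n}(x^n,y^n)\,P_{Y^n|X^n}(dy^n|x^n)\,P_{X^n}(dx^n)\le D$. Let $\mathbb I(P_{X^n},P_{Y^n|X^n})=\mathbb D(P_{X^n,Y^n}\,\|\,P_{X^n}\times P_{Y^n})\in[0,\infty]$ denote the mutual information, where $\mathbb D$ is the Kullback–Leibler divergence, $P_{X^n,Y^n}=P_{Y^n|X^n}\otimes P_{X^n}$ and $P_{Y^n}$ is its second marginal. The causal rate distortion function is $$R^c_{0,n}(D)=\inf_{P_{Y^n|X^n}\in\overrightarrow Q_{0,n}(D)}\mathbb I(P_{X^n},P_{Y^n|X^n}).$$ Suppose that $\mathcal Y_{0,n}$ is compact, that $d_{0,n}(x^n,\cdot)$ is continuous on $\mathcal Y_{0,n}$ for every $x^n\in\mathcal X_{0,n}$, and that $\overrightarrow Q_{0,n}(D)$ is non-empty. Then the infimum is attained: there is $P^*_{Y^n|X^n}\in\overrightarrow Q_{0,n}(D)$ with $\mathbb I(P_{X^n},P^*_{Y^n|X^n})=R^c_{0,n}(D)$. -/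

import Mathlib

open MeasureTheory ProbabilityTheory
open scoped ENNReal NNReal

noncomputable section

namespace CausalRD

/-- The space `Z₀ × ⋯ × Z_{k-1}` of histories of length `k` (a single point if `k = 0`). -/
abbrev Hist (Z : ℕ → Type*) (k : ℕ) : Type _ := ∀ j : Fin k, Z j

/-- The first `k` entries of a history of length `m ≥ k`. -/
def Hist.take {Z : ℕ → Type*} {k m : ℕ} (h : k ≤ m) (z : Hist Z m) : Hist Z k :=
  fun j => z (Fin.castLE h j)

/-- Append the entry `z_k` to the history `(z₀, …, z_{k-1})`. -/
def Hist.append {Z : ℕ → Type*} {k : ℕ} (p : Hist Z k × Z k) : Hist Z (k + 1) :=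
  Fin.snoc (α := fun j : Fin (k + 1) => Z j) p.1 p.2

section measurability

variable {Z : ℕ → Type*} [∀ i, MeasurableSpace (Z i)]

theorem Hist.measurable_take {k m : ℕ} (h : k ≤ m) :
    Measurable (Hist.take (Z := Z) h) :=
  measurable_pi_lambda _ fun j => measurable_pi_apply (Fin.castLE h j)

theorem Hist.measurable_append {k : ℕ} : Measurable (Hist.append (Z := Z) (k := k)) := by
  refine measurable_pi_lambda _ fun j => ?_
  refine Fin.lastCases ?_ (fun i => ?_) j
  · simpa [Hist.append, Fin.snoc_last] using measurable_snd
  · have : (fun p : Hist Z k × Z k => Hist.append p i.castSucc) = fun p => p.1 i := by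
      funext p
      exact Fin.snoc_castSucc (α := fun j : Fin (k + 1) => Z j) p.2 p.1 i
    rw [this]
    exact (measurable_pi_apply i).comp measurable_fst

end measurability

variable {X Y : ℕ → Type*} [∀ i, MeasurableSpace (X i)] [∀ i, MeasurableSpace (Y i)]

/-- The causal product `⊗_{i<k} q_i(dy_i | y^{i-1}, x^i)`, a kernel from `x^{k-1}` to
`y^{k-1}`. -/
def causalProd (q : ∀ i, Kernel (Hist X (i + 1) × Hist Y i) (Y i)) :
    ∀ k, Kernel (Hist X k) (Hist Y k)
  | 0 => Kernel.const _ (Measure.dirac fun j => j.elim0)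
  | k + 1 =>
    (((causalProd q k).comap (Hist.take k.le_succ) (Hist.measurable_take _)) ⊗ₖ q k).map
      Hist.append

/-- The realizability constraint for the source law `μ` of `X^n`: the conditional
distributions `κ(dy^n | x^n)` that agree, for `μ`-almost every `x^n`, with the causal product
of some conditional distributions `q_i(dy_i | y^{i-1}, x^i)`, `0 ≤ i ≤ n`. -/
def realizable {n : ℕ} (μ : Measure (Hist X (n + 1))) :
    Set (Kernel (Hist X (n + 1)) (Hist Y (n + 1))) :=
  {κ | IsMarkovKernel κ ∧
    ∃ q : ∀ i, Kernel (Hist X (i + 1) × Hist Y i) (Y i),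
      (∀ i ≤ n, IsMarkovKernel (q i)) ∧ ∀ᵐ x ∂μ, κ x = causalProd q (n + 1) x}

/-- `d_{0,n}(x^n, y^n) = ∑_{i=0}^n ρ_i(x^i, y^i)`. -/
def distortion {X Y : ℕ → Type*} (ρ : ∀ i, Hist X (i + 1) → Hist Y (i + 1) → ℝ≥0∞) (n : ℕ)
    (x : Hist X (n + 1)) (y : Hist Y (n + 1)) : ℝ≥0∞ :=
  ∑ i : Fin (n + 1), ρ i (x.take i.isLt) (y.take i.isLt)

/-- The realizable kernels whose average distortion is at most `D`. -/
def fidelitySet {n : ℕ} (μ : Measure (Hist X (n + 1)))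
    (ρ : ∀ i, Hist X (i + 1) → Hist Y (i + 1) → ℝ≥0∞) (D : ℝ≥0) :
    Set (Kernel (Hist X (n + 1)) (Hist Y (n + 1))) :=
  {κ | ∫⁻ p, distortion ρ n p.1 p.2 ∂(μ ⊗ₘ κ) ≤ D} ∩ realizable μ

/-- The mutual information `D(P_{XY} ‖ P_X × P_Y)` of an input with law `μ` and the output
of the channel `κ`. -/
def mutualInfo {A B : Type*} [MeasurableSpace A] [MeasurableSpace B] (μ : Measure A)
    (κ : Kernel A B) : ℝ≥0∞ :=
  InformationTheory.klDiv (μ ⊗ₘ κ) (μ.prod (κ ∘ₘ μ))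

/-- The causal rate distortion function. -/
def causalRDF {n : ℕ} (μ : Measure (Hist X (n + 1)))
    (ρ : ∀ i, Hist X (i + 1) → Hist Y (i + 1) → ℝ≥0∞) (D : ℝ≥0) : ℝ≥0∞ :=
  ⨅ κ ∈ fidelitySet μ ρ D, mutualInfo μ κ

end CausalRD

end

open Filter Topology InformationTheory
open scoped BoundedContinuousFunction

namespace CausalRD

section VariationalFormula

/-! ### The variational formula for the Kullback–Leibler divergence -/

/-! The proof is the direct method, carried out on joint laws `ν = μ ⊗ₘ κ` with the weak topology
instead of on kernels. Since the output space is compact and the source law is fixed, the laws with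
first marginal `μ` form a compact set (`isCompact_setOf_fst_eq`).

Realizability is not visibly closed in the factors `q i`, which need not converge along with the
joint laws. It is equivalent to a family of conditional independences, `IsCausal`: given the first
`k` inputs, the first `k` outputs are independent of the whole source
(`isCausal_compProd_causalProd`, `IsCausal.exists_causalProd`). Each of these is an equation linear
in `ν`, whose weights are only measurable in `x`. Because the first marginal is fixed, integrals of
functions measurable in `x` and continuous in `y` are still weakly continuous
(`continuousOn_integral_of_caratheodory`), so these equations are closed conditions.

The same fact makes the distortion lower semicontinuous. Mutual information is lower semicontinuous
because, by `klDiv_eq_iSup_boundedContinuous`, it is a supremum of continuous functionals. A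
minimizing joint law therefore exists, and disintegrating it gives the optimal kernel. -/

/-- Young's inequality: `exp t - 1` is the convex conjugate of `klFun`, with equality at `t = log
r`. -/
theorem mul_add_one_sub_exp_le_klFun {r : ℝ} (hr : 0 ≤ r) (t : ℝ) :
    r * t + 1 - Real.exp t ≤ klFun r := by
  rcases hr.eq_or_lt with rfl | hr
  · simpa [klFun_zero] using Real.exp_nonneg t
  · have h := mul_le_mul_of_nonneg_left (Real.add_one_le_exp (t - Real.log r)) hr.le
    rw [Real.exp_sub, Real.exp_log hr, mul_div_cancel₀ _ hr.ne'] at h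
    rw [klFun_apply]
    linarith

/-- For `u` between `1` and `r`, `(r - u) * log u` is nonnegative, so the expression dominates
`klFun u`. This supplies the nonnegativity that Fatou's lemma needs for truncated densities. -/
theorem mul_log_add_one_sub_nonneg {r u : ℝ} (hu : 0 < u) (h : (1 ≤ u ∧ u ≤ r) ∨ (r ≤ u ∧ u ≤ 1)) :
    0 ≤ r * Real.log u + 1 - u := by
  have hk := klFun_nonneg hu.le
  rw [klFun_apply] at hk
  rcases h with h | h
  · nlinarith [Real.log_nonneg h.1]
  · nlinarith [Real.log_nonpos hu.le h.2]

variable {Ω : Type*} [MeasurableSpace Ω]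

theorem integral_add_one_sub {π : Measure Ω} [IsProbabilityMeasure π] {f g : Ω → ℝ}
    (hf : Integrable f π) (hg : Integrable g π) :
    ∫ ω, (f ω + 1 - g ω) ∂π = ∫ ω, f ω ∂π + 1 - ∫ ω, g ω ∂π := by
  have h1 : Integrable (fun ω => f ω + 1) π := hf.add (integrable_const 1)
  rw [integral_sub h1 hg, integral_add hf (integrable_const 1)]
  simp

/-- The easy half of the variational formula: Young's inequality at `r = dν/dπ`, integrated against
`π`. -/
theorem ofReal_integral_sub_le_klDiv {ν π : Measure Ω} [IsProbabilityMeasure ν]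
    [IsProbabilityMeasure π] {f : Ω → ℝ} (hf : Measurable f) {B : ℝ} (hB : ∀ ω, |f ω| ≤ B) :
    ENNReal.ofReal (∫ ω, f ω ∂ν + 1 - ∫ ω, Real.exp (f ω) ∂π) ≤ klDiv ν π := by
  by_cases hac : ν ≪ π
  swap
  · simp [klDiv_of_not_ac hac]
  by_cases htop : klDiv ν π = ∞
  · simp [htop]
  obtain ⟨-, hllr⟩ := klDiv_ne_top_iff.1 htop
  have hkl : Integrable (fun ω => klFun (ν.rnDeriv π ω).toReal) π :=
    (integrable_klFun_rnDeriv_iff hac).2 hllr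
  have hfν : Integrable f ν := .of_bound hf.aestronglyMeasurable B (ae_of_all _ hB)
  have hexp : Integrable (fun ω => Real.exp (f ω)) π :=
    .of_bound hf.exp.aestronglyMeasurable (Real.exp B) (ae_of_all _ fun ω => by
      rw [Real.norm_eq_abs, Real.abs_exp]
      exact Real.exp_le_exp.2 ((le_abs_self _).trans (hB ω)))
  have hrf : Integrable (fun ω => (ν.rnDeriv π ω).toReal * f ω) π := by
    simpa only [smul_eq_mul] using (integrable_rnDeriv_smul_iff hac).2 hfν
  have hν : ∫ ω, f ω ∂ν = ∫ ω, (ν.rnDeriv π ω).toReal * f ω ∂π := by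
    simpa only [smul_eq_mul] using (integral_rnDeriv_smul hac (f := f)).symm
  rw [klDiv_eq_lintegral_klFun_of_ac hac, ← ofReal_integral_eq_lintegral_ofReal hkl
    (ae_of_all _ fun _ => klFun_nonneg ENNReal.toReal_nonneg)]
  refine ENNReal.ofReal_le_ofReal ?_
  have h1 : ∫ ω, ((ν.rnDeriv π ω).toReal * f ω + 1 - Real.exp (f ω)) ∂π
      = ∫ ω, f ω ∂ν + 1 - ∫ ω, Real.exp (f ω) ∂π := by
    rw [integral_add_one_sub hrf hexp, hν]
  rw [← h1]
  exact integral_mono ((hrf.add (integrable_const 1)).sub hexp) hkl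
    fun ω => mul_add_one_sub_exp_le_klFun ENNReal.toReal_nonneg _

/-- Bounds on the variational functional pass from bounded continuous to bounded measurable
functions. -/
theorem integral_sub_le_of_forall_boundedContinuous [TopologicalSpace Ω] [BorelSpace Ω]
    [TopologicalSpace.PseudoMetrizableSpace Ω] {ν π : Measure Ω} [IsProbabilityMeasure ν]
    [IsProbabilityMeasure π] {C : ℝ}
    (hC : ∀ f : Ω →ᵇ ℝ, ∫ ω, f ω ∂ν + 1 - ∫ ω, Real.exp (f ω) ∂π ≤ C)
    {f : Ω → ℝ} (hf : Measurable f) {B : ℝ} (hB : ∀ ω, |f ω| ≤ B) :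
    ∫ ω, f ω ∂ν + 1 - ∫ ω, Real.exp (f ω) ∂π ≤ C := by
  let := TopologicalSpace.pseudoMetrizableSpacePseudoMetric Ω
  refine le_of_forall_pos_le_add fun ε hε => ?_
  obtain ⟨ω₀⟩ : Nonempty Ω := ν.nonempty_of_neZero
  have hB0 : 0 ≤ B := (abs_nonneg _).trans (hB ω₀)
  have hint : ∀ m : Measure Ω, IsFiniteMeasure m → Integrable f m := fun m _ =>
    .of_bound hf.aestronglyMeasurable B (ae_of_all _ hB)
  have hexpB : 0 < 1 + Real.exp B := by positivity
  -- Approximating in `L¹(ν + π)` controls both integrals at once. The functional changes by at most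
  -- `1` times the `ν`-error plus `exp B` times the `π`-error, hence the constant `1 + exp B`.
  obtain ⟨g, hg, -⟩ := (hint (ν + π) inferInstance).exists_boundedContinuous_integral_sub_le
    (div_pos hε hexpB)
  -- Clipping to `[-B, B]` does not increase the distance to `f`, and it keeps the approximant where
  -- `exp` has slope at most `exp B`.
  let c : ℝ → ℝ := fun t => max (-B) (min B t)
  have hcc : Continuous c := by fun_prop
  have hcB : ∀ t, |c t| ≤ B := fun t =>
    abs_le.2 ⟨le_max_left _ _, max_le (by linarith) (min_le_left _ _)⟩
  have hclip : ∀ t s, |t| ≤ B → |t - c s| ≤ |t - s| := by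
    intro t s ht
    have h1 := abs_le.1 ht
    simp only [c]
    rcases le_total B s with h | h
    · rw [min_eq_left h, max_eq_right (by linarith), abs_le]
      constructor <;> cases abs_cases (t - s) <;> linarith
    · rw [min_eq_right h]
      rcases le_total (-B) s with h' | h'
      · rw [max_eq_right h']
      · rw [max_eq_left h', abs_le]
        constructor <;> cases abs_cases (t - s) <;> linarith
  let h : Ω →ᵇ ℝ := BoundedContinuousFunction.ofNormedAddCommGroup (fun ω => c (g ω))
    (hcc.comp g.continuous) B (fun ω => hcB _)
  have hh : ∀ ω, h ω = c (g ω) := fun _ => rfl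
  have hhB : ∀ ω, |h ω| ≤ B := fun ω => hcB _
  have hhint : ∀ m : Measure Ω, IsFiniteMeasure m → Integrable h m := fun m _ => h.integrable m
  have hexpi : ∀ k : Ω → ℝ, Measurable k → (∀ ω, |k ω| ≤ B) →
      Integrable (fun ω => Real.exp (k ω)) π := fun k hk hkB =>
    .of_bound hk.exp.aestronglyMeasurable (Real.exp B) (ae_of_all _ fun ω => by
      rw [Real.norm_eq_abs, Real.abs_exp]
      exact Real.exp_le_exp.2 ((le_abs_self _).trans (hkB ω)))
  have habs : ∀ m : Measure Ω, IsFiniteMeasure m → Integrable (fun ω => |f ω - h ω|) m :=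
    fun m hm => ((hint m hm).sub (hhint m hm)).abs
  have hsum : ∫ ω, |f ω - h ω| ∂ν + ∫ ω, |f ω - h ω| ∂π ≤ ε / (1 + Real.exp B) := by
    rw [← integral_add_measure (habs ν inferInstance) (habs π inferInstance)]
    refine le_trans (integral_mono (habs _ inferInstance) ?_ fun ω => hclip _ _ (hB ω)) hg
    exact ((hint _ inferInstance).sub (g.integrable _)).abs
  have e1 : ∫ ω, f ω ∂ν - ∫ ω, h ω ∂ν ≤ ∫ ω, |f ω - h ω| ∂ν := by
    rw [← integral_sub (hint ν inferInstance) (hhint ν inferInstance)]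
    exact integral_mono ((hint ν inferInstance).sub (hhint ν inferInstance))
      (habs ν inferInstance) fun ω => le_abs_self _
  have hlip : ∀ s t : ℝ, |s| ≤ B → Real.exp s - Real.exp t ≤ Real.exp B * |t - s| := by
    intro s t hs
    have h1 := Real.add_one_le_exp (t - s)
    have h2 : Real.exp t = Real.exp s * Real.exp (t - s) := by rw [← Real.exp_add]; ring_nf
    have h3 : Real.exp s ≤ Real.exp B := Real.exp_le_exp.2 ((le_abs_self _).trans hs)
    have h4 := Real.exp_pos s
    calc Real.exp s - Real.exp t ≤ Real.exp s * (s - t) := by rw [h2]; nlinarith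
      _ ≤ Real.exp s * |t - s| := by gcongr; rw [abs_sub_comm]; exact le_abs_self _
      _ ≤ Real.exp B * |t - s| := by gcongr
  have e2 : ∫ ω, Real.exp (h ω) ∂π - ∫ ω, Real.exp (f ω) ∂π
      ≤ Real.exp B * ∫ ω, |f ω - h ω| ∂π := by
    rw [← integral_sub (hexpi _ h.continuous.measurable hhB) (hexpi _ hf hB),
      ← integral_const_mul]
    exact integral_mono ((hexpi _ h.continuous.measurable hhB).sub (hexpi _ hf hB))
      ((habs π inferInstance).const_mul _) fun ω => hlip _ _ (hhB ω)
  have p1 : 0 ≤ ∫ ω, |f ω - h ω| ∂ν := integral_nonneg fun _ => abs_nonneg _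
  have p2 : 0 ≤ ∫ ω, |f ω - h ω| ∂π := integral_nonneg fun _ => abs_nonneg _
  have e3 := hC h
  rw [le_div_iff₀ hexpB] at hsum
  nlinarith [mul_nonneg p1 (Real.exp_pos B).le]

/-- The ideal test function is `log r` with `r = dν/dπ`, for which the functional is formally `∫
klFun r ∂π`. It may be unbounded, so `r` is truncated and Fatou's lemma recovers the limit. -/
theorem klDiv_le_of_forall_measurable {ν π : Measure Ω} [IsProbabilityMeasure ν]
    [IsProbabilityMeasure π] {C : ℝ}
    (hC : ∀ f : Ω → ℝ, Measurable f → (∃ B, ∀ ω, |f ω| ≤ B) →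
      ∫ ω, f ω ∂ν + 1 - ∫ ω, Real.exp (f ω) ∂π ≤ C) :
    klDiv ν π ≤ ENNReal.ofReal C := by
  have hac : ν ≪ π := by
    refine Measure.AbsolutelyContinuous.mk fun s hs hπ => ?_
    by_contra hne
    have hpos : 0 < ν.real s := (measureReal_nonneg).lt_of_ne' (by
      simpa [Measure.real, ENNReal.toReal_eq_zero_iff] using hne)
    -- On a `π`-null set the exponential term is blind to the test function; this height makes the
    -- functional equal to `|C| + 1`, which exceeds `C`.
    let t : ℝ := (|C| + 1) / ν.real s
    have ht : 0 ≤ t := by positivity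
    have h := hC (s.indicator fun _ => t) (measurable_const.indicator hs) ⟨t, fun ω => by
      by_cases hω : ω ∈ s <;> simp [hω, abs_of_nonneg ht, ht]⟩
    have he : ∫ ω, Real.exp (s.indicator (fun _ => t) ω) ∂π = ∫ _, (1 : ℝ) ∂π := by
      refine integral_congr_ae ?_
      filter_upwards [measure_eq_zero_iff_ae_notMem.1 hπ] with ω hω
      simp [hω]
    rw [he, integral_indicator_const _ hs] at h
    simp only [smul_eq_mul, integral_const, probReal_univ, mul_one, t,
      mul_div_cancel₀ _ hpos.ne'] at h
    linarith [le_abs_self C]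
  rw [klDiv_eq_lintegral_klFun_of_ac hac]
  let r : Ω → ℝ := fun ω => (ν.rnDeriv π ω).toReal
  have hr : Measurable r := (Measure.measurable_rnDeriv ν π).ennreal_toReal
  have hr0 : ∀ ω, 0 ≤ r ω := fun _ => ENNReal.toReal_nonneg
  -- The window `[1/(m+1), m+1]` contains `1`, so the truncation always lies between `1` and its
  -- argument and its logarithm is bounded.
  let u : ℕ → ℝ → ℝ := fun m t => max (1 / ((m : ℝ) + 1)) (min ((m : ℝ) + 1) t)
  have hu0 : ∀ m t, 0 < u m t := fun m t => lt_of_lt_of_le (by positivity) (le_max_left _ _)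
  have hum : ∀ m, Measurable (u m) := fun m => by fun_prop
  have hle1 : ∀ m : ℕ, 1 / ((m : ℝ) + 1) ≤ 1 := fun m => by
    rw [div_le_one (by positivity)]
    linarith [(m.cast_nonneg : (0 : ℝ) ≤ m)]
  have hge1 : ∀ m : ℕ, 1 ≤ (m : ℝ) + 1 := fun m => by linarith [(m.cast_nonneg : (0 : ℝ) ≤ m)]
  have hub : ∀ m t, u m t ≤ (m : ℝ) + 1 := fun m t =>
    max_le ((hle1 m).trans (hge1 m)) (min_le_left _ _)
  have hcase : ∀ m t, (1 ≤ u m t ∧ u m t ≤ t) ∨ (t ≤ u m t ∧ u m t ≤ 1) := by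
    intro m t
    rcases le_total 1 t with ht | ht
    · refine Or.inl ⟨le_max_of_le_right (le_min (hge1 m) ht), max_le ((hle1 m).trans ht)
        (min_le_right _ _)⟩
    · refine Or.inr ⟨?_, max_le (hle1 m) ((min_le_right _ _).trans ht)⟩
      exact le_max_of_le_right (le_min (ht.trans (hge1 m)) le_rfl)
  have hlogB : ∀ m t, |Real.log (u m t)| ≤ Real.log ((m : ℝ) + 1) := by
    intro m t
    rw [abs_le, ← Real.log_inv, ← one_div]
    exact ⟨Real.log_le_log (by positivity) (le_max_left _ _), Real.log_le_log (hu0 m t) (hub m t)⟩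
  let F : ℕ → Ω → ℝ := fun m ω => r ω * Real.log (u m (r ω)) + 1 - u m (r ω)
  have hF0 : ∀ m ω, 0 ≤ F m ω := fun m ω => mul_log_add_one_sub_nonneg (hu0 _ _) (hcase _ _)
  have hlim : ∀ ω, Tendsto (fun m => ENNReal.ofReal (F m ω)) atTop
      (𝓝 (ENNReal.ofReal (klFun (r ω)))) := by
    intro ω
    refine (ENNReal.continuous_ofReal.tendsto _).comp ?_
    have hulim : Tendsto (fun m => u m (r ω)) atTop (𝓝 (r ω)) := by
      have h1 : Tendsto (fun m : ℕ => min ((m : ℝ) + 1) (r ω)) atTop (𝓝 (r ω)) := by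
        refine tendsto_const_nhds.congr' ?_
        filter_upwards [eventually_ge_atTop ⌈r ω⌉₊] with m hm
        exact (min_eq_right ((Nat.ceil_le.1 hm).trans (by linarith))).symm
      have h2 := (tendsto_one_div_add_atTop_nhds_zero_nat (𝕜 := ℝ)).max h1
      rwa [max_eq_right (hr0 ω)] at h2
    -- At `r ω = 0` the logarithm diverges, but its factor is exactly zero.
    rcases (hr0 ω).eq_or_lt with h0 | h0
    · simp only [F, ← h0, klFun_zero]
      rw [← h0] at hulim
      simpa using hulim.const_sub 1
    · rw [klFun_apply]
      exact (((hulim.log h0.ne').const_mul _).add_const 1).sub hulim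
  have hFm : ∀ m, Measurable (F m) := fun m => by
    have h1 : Measurable fun ω => u m (r ω) := (hum m).comp hr
    exact ((hr.mul h1.log).add_const 1).sub h1
  have hbound : ∀ m, ∫⁻ ω, ENNReal.ofReal (F m ω) ∂π ≤ ENNReal.ofReal C := by
    intro m
    have h1 : Measurable fun ω => u m (r ω) := (hum m).comp hr
    have hl : Integrable (fun ω => Real.log (u m (r ω))) ν :=
      .of_bound h1.log.aestronglyMeasurable _ (ae_of_all _ fun ω => hlogB m _)
    have hrl : Integrable (fun ω => r ω * Real.log (u m (r ω))) π := by
      simpa only [smul_eq_mul] using (integrable_rnDeriv_smul_iff hac).2 hl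
    have hν : ∫ ω, Real.log (u m (r ω)) ∂ν = ∫ ω, r ω * Real.log (u m (r ω)) ∂π := by
      simpa only [smul_eq_mul] using
        (integral_rnDeriv_smul hac (f := fun ω => Real.log (u m (r ω)))).symm
    have hui : Integrable (fun ω => u m (r ω)) π :=
      .of_bound h1.aestronglyMeasurable ((m : ℝ) + 1) (ae_of_all _ fun ω => by
        rw [Real.norm_eq_abs, abs_of_pos (hu0 _ _)]
        exact hub m _)
    have hFi : Integrable (F m) π := (hrl.add (integrable_const 1)).sub hui
    rw [← ofReal_integral_eq_lintegral_ofReal hFi (ae_of_all _ (hF0 m))]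
    refine ENNReal.ofReal_le_ofReal ?_
    have h2 := hC (fun ω => Real.log (u m (r ω))) h1.log ⟨_, fun ω => hlogB m _⟩
    simp only [Real.exp_log (hu0 _ _)] at h2
    have h3 : ∫ ω, F m ω ∂π
        = ∫ ω, Real.log (u m (r ω)) ∂ν + 1 - ∫ ω, u m (r ω) ∂π := by
      rw [hν]
      exact integral_add_one_sub hrl hui
    rwa [h3]
  calc ∫⁻ ω, ENNReal.ofReal (klFun (r ω)) ∂π
      = ∫⁻ ω, liminf (fun m => ENNReal.ofReal (F m ω)) atTop ∂π :=
        lintegral_congr fun ω => (hlim ω).liminf_eq.symm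
    _ ≤ liminf (fun m => ∫⁻ ω, ENNReal.ofReal (F m ω) ∂π) atTop :=
        lintegral_liminf_le fun m => (hFm m).ennreal_ofReal
    _ ≤ liminf (fun _ => ENNReal.ofReal C) atTop := liminf_le_liminf (.of_forall hbound)
    _ = ENNReal.ofReal C := by simp

/-- The **Donsker–Varadhan** type variational formula for the Kullback–Leibler divergence. -/
theorem klDiv_eq_iSup_boundedContinuous [TopologicalSpace Ω] [BorelSpace Ω]
    [TopologicalSpace.PseudoMetrizableSpace Ω] (ν π : Measure Ω) [IsProbabilityMeasure ν]
    [IsProbabilityMeasure π] :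
    klDiv ν π
      = ⨆ f : Ω →ᵇ ℝ, ENNReal.ofReal (∫ ω, f ω ∂ν + 1 - ∫ ω, Real.exp (f ω) ∂π) := by
  refine le_antisymm ?_ (iSup_le fun f => ofReal_integral_sub_le_klDiv f.continuous.measurable
    (B := ‖f‖) fun ω => f.norm_coe_le_norm ω)
  set c := ⨆ f : Ω →ᵇ ℝ, ENNReal.ofReal (∫ ω, f ω ∂ν + 1 - ∫ ω, Real.exp (f ω) ∂π) with hc
  by_cases htop : c = ∞
  · simp [htop]
  rw [← ENNReal.ofReal_toReal htop]
  refine klDiv_le_of_forall_measurable fun f hf ⟨B, hB⟩ =>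
    integral_sub_le_of_forall_boundedContinuous (fun g => ?_) hf hB
  exact (ENNReal.ofReal_le_iff_le_toReal htop).1
    (le_iSup (fun f : Ω →ᵇ ℝ => ENNReal.ofReal (∫ ω, f ω ∂ν + 1 - ∫ ω, Real.exp (f ω) ∂π)) g)

end VariationalFormula

/-! ### Measures on a product with a prescribed first marginal -/

section Caratheodory

variable {A B : Type*} [MeasurableSpace A]
  [TopologicalSpace B] [CompactSpace B] [TopologicalSpace.MetrizableSpace B]

/-- By continuity, a uniform bound need only be tested on a countable dense set. -/
theorem measurableSet_dist_continuousMap_le {F : A → C(B, ℝ)}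
    (hF : ∀ b, Measurable fun a => F a b) (g : C(B, ℝ)) (r : ℝ) :
    MeasurableSet {a | dist (F a) g ≤ r} := by
  rcases lt_or_ge r 0 with hr | hr
  · convert MeasurableSet.empty
    ext a
    simpa using hr.trans_le dist_nonneg
  obtain ⟨s, hsc, hsd⟩ := TopologicalSpace.exists_countable_dense B
  have : {a | dist (F a) g ≤ r} = ⋂ b ∈ s, {a | dist (F a b) (g b) ≤ r} := by
    ext a
    simp only [Set.mem_ofPred_eq, Set.mem_iInter, ContinuousMap.dist_le hr]
    refine ⟨fun h b _ => h b, fun h b => ?_⟩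
    have hcl : IsClosed {b | dist (F a b) (g b) ≤ r} :=
      isClosed_le (by fun_prop) continuous_const
    exact hcl.closure_subset_iff.2 (fun b hb => h b hb) (hsd b)
  rw [this]
  exact MeasurableSet.biInter hsc fun b _ =>
    measurableSet_le ((hF b).dist measurable_const) measurable_const

/-- A map into `C(B, ℝ)` is measurable if its evaluations are. -/
theorem measurable_continuousMap_of_eval [MeasurableSpace C(B, ℝ)] [BorelSpace C(B, ℝ)]
    {F : A → C(B, ℝ)} (hF : ∀ b, Measurable fun a => F a b) : Measurable F := by
  have hdist : ∀ g, Measurable fun a => dist (F a) g := fun g =>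
    measurable_of_Iic fun r => measurableSet_dist_continuousMap_le hF g r
  refine measurable_of_isOpen fun U hU => ?_
  choose! r hr hrU using Metric.isOpen_iff.1 hU
  obtain ⟨T, hTU, hT, hcover⟩ := TopologicalSpace.isOpen_biUnion_countable U
    (fun g => Metric.ball g (r g)) fun g _ => Metric.isOpen_ball
  have hUeq : U = ⋃ g ∈ T, Metric.ball g (r g) := by
    rw [hcover]
    refine Set.Subset.antisymm (fun g hg => ?_) (Set.iUnion₂_subset fun g hg => hrU g hg)
    exact Set.mem_biUnion hg (Metric.mem_ball_self (hr g hg))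
  rw [hUeq, Set.preimage_iUnion₂]
  exact MeasurableSet.biUnion hT fun g _ => measurableSet_lt (hdist g) measurable_const

variable [TopologicalSpace A] [PolishSpace A] [BorelSpace A]
  [MeasurableSpace B] [BorelSpace B]

/-- Integrals of bounded Carathéodory functions depend continuously on the measure as long as
its first marginal is fixed. -/
theorem continuousOn_integral_of_caratheodory (μ : Measure A) [IsProbabilityMeasure μ]
    {f : A → B → ℝ} (hf : Measurable (Function.uncurry f)) (hc : ∀ a, Continuous (f a))
    {M : ℝ} (hM : ∀ a b, |f a b| ≤ M) :
    ContinuousOn (fun ν : ProbabilityMeasure (A × B) => ∫ p, f p.1 p.2 ∂(ν : Measure (A × B)))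
      {ν | (ν : Measure (A × B)).fst = μ} := by
  let := borel C(B, ℝ)
  have : BorelSpace C(B, ℝ) := ⟨rfl⟩
  -- Seen as a `C(B, ℝ)`-valued map, `f` is Bochner integrable for `μ` and can be approximated in
  -- `L¹(μ)` by a bounded continuous `g`. The resulting error in the integral is at most `∫ ‖F - g‖
  -- ∂μ`, uniformly over all `ν` with first marginal `μ`.
  let F : A → C(B, ℝ) := fun a => ⟨f a, hc a⟩
  have hF : Measurable F := measurable_continuousMap_of_eval fun b =>
    hf.comp (measurable_id.prodMk measurable_const)
  have hFi : Integrable F μ := .of_bound hF.aestronglyMeasurable |M| (ae_of_all _ fun a =>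
    (ContinuousMap.norm_le _ (abs_nonneg M)).2 fun b => (hM a b).trans (le_abs_self M))
  refine continuousOn_of_uniform_approx_of_continuousOn fun u hu => ?_
  obtain ⟨ε, hε, hεu⟩ := Metric.mem_uniformity_dist.1 hu
  let := TopologicalSpace.upgradeIsCompletelyMetrizable A
  obtain ⟨g, hg, hgi⟩ := hFi.exists_boundedContinuous_integral_sub_le (half_pos hε)
  let G : A × B →ᵇ ℝ := BoundedContinuousFunction.ofNormedAddCommGroup (fun p => g p.1 p.2)
    (by fun_prop) ‖g‖ fun p => ((g p.1).norm_coe_le_norm p.2).trans (g.norm_coe_le_norm p.1)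
  refine ⟨fun ν => ∫ p, G p ∂(ν : Measure (A × B)),
    (ProbabilityMeasure.continuous_integral_boundedContinuousFunction G).continuousOn,
    fun ν hν => hεu ?_⟩
  have hfi : Integrable (fun p : A × B => f p.1 p.2) (ν : Measure (A × B)) :=
    .of_bound hf.aestronglyMeasurable M (ae_of_all _ fun p => hM p.1 p.2)
  have hdi : Integrable (fun a => ‖F a - g a‖) (Measure.fst (ν : Measure (A × B))) := by
    rw [hν]
    exact (hFi.sub hgi).norm
  rw [Real.dist_eq, ← integral_sub hfi (G.integrable _), ← Real.norm_eq_abs]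
  calc ‖∫ p, (f p.1 p.2 - G p) ∂(ν : Measure (A × B))‖
      ≤ ∫ p, ‖F p.1 - g p.1‖ ∂(ν : Measure (A × B)) :=
        norm_integral_le_of_norm_le (hdi.comp_measurable measurable_fst)
          (ae_of_all _ fun p => (F p.1 - g p.1).norm_coe_le_norm p.2)
    _ = ∫ a, ‖F a - g a‖ ∂(Measure.fst (ν : Measure (A × B))) :=
        (integral_map measurable_fst.aemeasurable hdi.aestronglyMeasurable).symm
    _ ≤ ε / 2 := by rw [hν]; exact hg
    _ < ε := half_lt_self hε

/-- The integral of a nonnegative Carathéodory function is lower semicontinuous in the measure as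
long as its first marginal is fixed. -/
theorem lowerSemicontinuousOn_lintegral_of_caratheodory (μ : Measure A) [IsProbabilityMeasure μ]
    {f : A → B → ℝ≥0∞} (hf : Measurable (Function.uncurry f)) (hc : ∀ a, Continuous (f a)) :
    LowerSemicontinuousOn
      (fun ν : ProbabilityMeasure (A × B) => ∫⁻ p, f p.1 p.2 ∂(ν : Measure (A × B)))
      {ν | (ν : Measure (A × B)).fst = μ} := by
  have hfm : ∀ N : ℕ, Measurable fun p : A × B => min (f p.1 p.2) N := fun N =>
    hf.min measurable_const
  have htop : ∀ (N : ℕ) (x : ℝ≥0∞), min x N ≠ ∞ := fun N x =>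
    ((min_le_right _ _).trans_lt (ENNReal.natCast_lt_top N)).ne
  have hb : ∀ (N : ℕ) (a : A) (b : B), |(min (f a b) N).toReal| ≤ N := fun N a b => by
    rw [abs_of_nonneg ENNReal.toReal_nonneg]
    exact ENNReal.toReal_le_of_le_ofReal N.cast_nonneg (by simp)
  -- The truncations are bounded Carathéodory functions, so the integral is a supremum of
  -- functionals continuous on this set.
  have heq : ∀ ν : ProbabilityMeasure (A × B), ∫⁻ p, f p.1 p.2 ∂(ν : Measure (A × B))
      = ⨆ N : ℕ, ENNReal.ofReal (∫ p, (min (f p.1 p.2) N).toReal ∂(ν : Measure (A × B))) := by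
    intro ν
    have h1 : ∀ p : A × B, f p.1 p.2 = ⨆ N : ℕ, min (f p.1 p.2) N := fun p => by
      rw [← inf_iSup_eq, ENNReal.iSup_natCast, inf_top_eq]
    rw [lintegral_congr h1, lintegral_iSup hfm fun N M h p =>
      min_le_min_left _ (Nat.cast_le.2 h)]
    refine iSup_congr fun N => ?_
    rw [ofReal_integral_eq_lintegral_ofReal
      (.of_bound (hfm N).ennreal_toReal.aestronglyMeasurable N (ae_of_all _ fun p => hb N p.1 p.2))
      (ae_of_all _ fun p => ENNReal.toReal_nonneg)]
    exact lintegral_congr fun p => (ENNReal.ofReal_toReal (htop N _)).symm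
  simp_rw [heq]
  refine lowerSemicontinuousOn_iSup fun N => ContinuousOn.lowerSemicontinuousOn ?_
  refine ENNReal.continuous_ofReal.comp_continuousOn ?_
  refine continuousOn_integral_of_caratheodory μ (hfm N).ennreal_toReal (fun a => ?_) (hb N)
  exact ENNReal.continuousOn_toReal.comp_continuous ((hc a).min continuous_const)
    fun b => htop N _

/-- The probability measures on `A × B` with first marginal `μ` form a compact set if `B` is
compact. -/
theorem isCompact_setOf_fst_eq [SecondCountableTopology B] (μ : Measure A)
    [IsProbabilityMeasure μ] :
    IsCompact {ν : ProbabilityMeasure (A × B) | (ν : Measure (A × B)).fst = μ} := by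
  have hcl : IsClosed {ν : ProbabilityMeasure (A × B) | (ν : Measure (A × B)).fst = μ} := by
    let μ' : ProbabilityMeasure A := ⟨μ, inferInstance⟩
    have h : {ν : ProbabilityMeasure (A × B) | (ν : Measure (A × B)).fst = μ}
        = (fun ν : ProbabilityMeasure (A × B) =>
          ν.map continuous_fst.measurable.aemeasurable) ⁻¹' {μ'} :=
      Set.ext fun ν => (ProbabilityMeasure.toMeasure_injective.eq_iff
        (a := ν.map continuous_fst.measurable.aemeasurable) (b := μ'))
    rw [h]
    exact isClosed_singleton.preimage (ProbabilityMeasure.continuous_map continuous_fst)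
  rw [← hcl.closure_eq]
  -- Prokhorov: the first marginals are the single tight law `μ`, and the second ones live on a
  -- compact space.
  refine isCompact_closure_of_isTightMeasureSet (IsTightMeasureSet.prodMk ?_ ?_)
  · refine (isTightMeasureSet_singleton (μ := μ)).subset ?_
    rintro _ ⟨_, ⟨ν, hν, rfl⟩, rfl⟩
    exact hν
  · exact IsTightMeasureSet.of_compactSpace

end Caratheodory

/-! ### Lower semicontinuity of mutual information -/

section MutualInformation

variable {A B : Type*} [MeasurableSpace A] [TopologicalSpace A] [PolishSpace A] [BorelSpace A]
  [TopologicalSpace B] [TopologicalSpace.MetrizableSpace B] [SecondCountableTopology B]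
  [MeasurableSpace B] [BorelSpace B]

/-- The mutual information is lower semicontinuous in the joint law. -/
theorem lowerSemicontinuous_klDiv_prod_snd (μ : Measure A)
    [IsProbabilityMeasure μ] :
    LowerSemicontinuous fun ν : ProbabilityMeasure (A × B) =>
      klDiv (ν : Measure (A × B)) (μ.prod (ν : Measure (A × B)).snd) := by
  simp_rw [klDiv_eq_iSup_boundedContinuous]
  refine lowerSemicontinuous_iSup fun f => Continuous.lowerSemicontinuous ?_
  refine ENNReal.continuous_ofReal.comp (((
    ProbabilityMeasure.continuous_integral_boundedContinuousFunction f).add_const 1).sub ?_)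
  have hexp : ∀ p, ‖Real.exp (f p)‖ ≤ Real.exp ‖f‖ := fun p => by
    rw [Real.norm_eq_abs, Real.abs_exp]
    exact Real.exp_le_exp.2 ((le_abs_self _).trans (f.norm_coe_le_norm p))
  have hec : Continuous fun p => Real.exp (f p) := by fun_prop
  have hH : Continuous fun b => ∫ a, Real.exp (f (a, b)) ∂μ :=
    continuous_of_dominated (bound := fun _ => Real.exp ‖f‖)
      (fun b => (hec.comp (by fun_prop : Continuous fun a : A => (a, b))).aestronglyMeasurable)
      (fun b => ae_of_all _ fun a => hexp _) (integrable_const _)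
      (ae_of_all _ fun a => hec.comp (by fun_prop : Continuous fun b : B => (a, b)))
  -- The product law also depends on `ν`, but integrating out `μ` turns its exponential term into
  -- the `ν`-integral of the bounded continuous `H`.
  let H : A × B →ᵇ ℝ := BoundedContinuousFunction.ofNormedAddCommGroup
    (fun p => ∫ a, Real.exp (f (a, p.2)) ∂μ) (hH.comp continuous_snd) (Real.exp ‖f‖) fun p => by
      simpa using norm_integral_le_of_norm_le_const (μ := μ) (ae_of_all _ fun a => hexp (a, p.2))
  have h := ProbabilityMeasure.continuous_integral_boundedContinuousFunction H
  refine h.congr fun ν => ?_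
  have hint : Integrable (fun p => Real.exp (f p)) (μ.prod (ν : Measure (A × B)).snd) :=
    .of_bound hec.aestronglyMeasurable _ (ae_of_all _ hexp)
  rw [integral_prod_symm _ hint, Measure.snd,
    integral_map measurable_snd.aemeasurable hH.aestronglyMeasurable]
  rfl

end MutualInformation

/-! ### Weighted laws -/

section WeightedLaw

variable {A B B' : Type*} [MeasurableSpace A] [MeasurableSpace B] [MeasurableSpace B']

/-- The law of `T b` under the measure with density `w a` with respect to `ν(da, db)`. -/
noncomputable def weightedLaw (w : A → ℝ≥0∞) (T : B → B') (ν : Measure (A × B)) : Measure B' :=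
  (ν.withDensity fun p => w p.1).map fun p => T p.2

theorem weightedLaw_apply {w : A → ℝ≥0∞} (hw : Measurable w) {T : B → B'} (hT : Measurable T)
    (ν : Measure (A × B)) {s : Set B'} (hs : MeasurableSet s) :
    weightedLaw w T ν s = ∫⁻ p, w p.1 * s.indicator 1 (T p.2) ∂ν := by
  have hTm : Measurable fun p : A × B => T p.2 := hT.comp measurable_snd
  have hwm : Measurable fun p : A × B => w p.1 := hw.comp measurable_fst
  have hi : Measurable fun p : A × B => s.indicator (1 : B' → ℝ≥0∞) (T p.2) :=
    (measurable_one.indicator hs).comp hTm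
  rw [weightedLaw, ← lintegral_indicator_one hs, lintegral_map (measurable_one.indicator hs) hTm,
    lintegral_withDensity_eq_lintegral_mul _ hwm hi]
  rfl

theorem weightedLaw_compProd_apply {w : A → ℝ≥0∞} (hw : Measurable w) {T : B → B'}
    (hT : Measurable T) (μ : Measure A) [SFinite μ] (κ : Kernel A B) [IsSFiniteKernel κ]
    {s : Set B'} (hs : MeasurableSet s) :
    weightedLaw w T (μ ⊗ₘ κ) s = ∫⁻ a, w a * κ a (T ⁻¹' s) ∂μ := by
  have hi : Measurable fun b => s.indicator (1 : B' → ℝ≥0∞) (T b) :=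
    (measurable_one.indicator hs).comp hT
  have hF : Measurable fun p : A × B => w p.1 * s.indicator (1 : B' → ℝ≥0∞) (T p.2) :=
    (hw.comp measurable_fst).mul (hi.comp measurable_snd)
  rw [weightedLaw_apply hw hT _ hs, Measure.lintegral_compProd hF]
  refine lintegral_congr fun a => ?_
  dsimp only
  rw [lintegral_const_mul _ hi, ← lintegral_indicator_one (hT hs)]
  rfl

theorem isFiniteMeasure_weightedLaw {w : A → ℝ≥0∞} (hw1 : ∀ a, w a ≤ 1) (T : B → B')
    (ν : Measure (A × B)) [IsFiniteMeasure ν] : IsFiniteMeasure (weightedLaw w T ν) := by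
  have : IsFiniteMeasure (ν.withDensity fun p => w p.1) :=
    isFiniteMeasure_withDensity (ne_top_of_le_ne_top (b := ∫⁻ _, 1 ∂ν) (by simp)
      (lintegral_mono fun p => hw1 p.1))
  exact Measure.isFiniteMeasure_map _ _

theorem integral_weightedLaw [TopologicalSpace B'] [BorelSpace B'] {w : A → ℝ≥0∞}
    (hw : Measurable w) (hw1 : ∀ a, w a ≤ 1) {T : B → B'} (hT : Measurable T)
    (ν : Measure (A × B)) (g : B' →ᵇ ℝ) :
    ∫ b, g b ∂(weightedLaw w T ν) = ∫ p, (w p.1).toReal * g (T p.2) ∂ν := by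
  have hTm : Measurable fun p : A × B => T p.2 := hT.comp measurable_snd
  have hwm : Measurable fun p : A × B => w p.1 := hw.comp measurable_fst
  rw [weightedLaw, integral_map hTm.aemeasurable
    g.continuous.measurable.aestronglyMeasurable, integral_withDensity_eq_integral_toReal_smul
    hwm (ae_of_all _ fun p => (hw1 p.1).trans_lt ENNReal.one_lt_top)]
  rfl

variable [TopologicalSpace A] [PolishSpace A] [BorelSpace A]
  [TopologicalSpace B] [CompactSpace B] [TopologicalSpace.MetrizableSpace B] [BorelSpace B]
  [SecondCountableTopology B]
  [TopologicalSpace B'] [TopologicalSpace.PseudoMetrizableSpace B'] [BorelSpace B']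

/-- Tested against bounded continuous `g`, both sides integrate a Carathéodory function `w a * g (T
b)`, so discontinuity of the weights is harmless once the first marginal is fixed. -/
theorem isClosed_setOf_weightedLaw_eq (μ : Measure A) [IsProbabilityMeasure μ]
    {w w' : A → ℝ≥0∞} (hw : Measurable w) (hw1 : ∀ a, w a ≤ 1)
    (hw' : Measurable w') (hw1' : ∀ a, w' a ≤ 1) {T : B → B'} (hT : Continuous T) :
    IsClosed {ν : ProbabilityMeasure (A × B) | (ν : Measure (A × B)).fst = μ ∧
      weightedLaw w T (ν : Measure (A × B)) = weightedLaw w' T (ν : Measure (A × B))} := by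
  let := TopologicalSpace.pseudoMetrizableSpacePseudoMetric B'
  let S : Set (ProbabilityMeasure (A × B)) := {ν | (ν : Measure (A × B)).fst = μ}
  have hS : IsClosed S := (isCompact_setOf_fst_eq μ).isClosed
  have hcont : ∀ v : A → ℝ≥0∞, Measurable v → (∀ a, v a ≤ 1) → ∀ g : B' →ᵇ ℝ,
      ContinuousOn (fun ν : ProbabilityMeasure (A × B) =>
        ∫ b, g b ∂(weightedLaw v T (ν : Measure (A × B)))) S := by
    intro v hv hv1 g
    simp_rw [integral_weightedLaw hv hv1 hT.measurable]
    refine continuousOn_integral_of_caratheodory μ (f := fun a b => (v a).toReal * g (T b))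
      ?_ (fun a => by fun_prop) (M := ‖g‖) fun a b => ?_
    · exact (hv.ennreal_toReal.comp measurable_fst).mul
        ((g.continuous.comp hT).measurable.comp measurable_snd)
    · rw [abs_mul, abs_of_nonneg ENNReal.toReal_nonneg]
      refine (mul_le_mul (ENNReal.toReal_mono ENNReal.one_ne_top (hv1 a))
        (g.norm_coe_le_norm (T b)) (abs_nonneg _) (by simp)).trans (by simp)
  have heq : {ν : ProbabilityMeasure (A × B) | (ν : Measure (A × B)).fst = μ ∧
      weightedLaw w T (ν : Measure (A × B)) = weightedLaw w' T (ν : Measure (A × B))}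
      = ⋂ g : B' →ᵇ ℝ, S ∩ (fun ν : ProbabilityMeasure (A × B) =>
        ∫ b, g b ∂(weightedLaw w T (ν : Measure (A × B)))
          - ∫ b, g b ∂(weightedLaw w' T (ν : Measure (A × B)))) ⁻¹' {0} := by
    ext ν
    simp only [Set.mem_iInter, Set.mem_inter_iff, Set.mem_preimage, Set.mem_singleton_iff,
      sub_eq_zero, forall_and, forall_const]
    refine and_congr Iff.rfl ⟨fun h g => by rw [h], fun h => ?_⟩
    have := isFiniteMeasure_weightedLaw hw1 T (ν : Measure (A × B))
    have := isFiniteMeasure_weightedLaw hw1' T (ν : Measure (A × B))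
    exact ext_of_forall_integral_eq_of_IsFiniteMeasure h
  rw [heq]
  exact isClosed_iInter fun g =>
    ((hcont w hw hw1 g).sub (hcont w' hw' hw1' g)).preimage_isClosed_of_isClosed hS
      isClosed_singleton

end WeightedLaw

/-! ### Causal products -/

section CausalProd

theorem Hist.take_append {Y : ℕ → Type*} {k m : ℕ} (h : k ≤ m) (p : Hist Y m × Y m) :
    Hist.take (h.trans m.le_succ) (Hist.append p) = Hist.take h p.1 := by
  funext j
  exact Fin.snoc_castSucc (α := fun j : Fin (m + 1) => Y j) p.2 p.1 (Fin.castLE h j)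

theorem Hist.append_take {Y : ℕ → Type*} {k m : ℕ} (h : k < m) (y : Hist Y m) :
    Hist.append (Hist.take h.le y, y ⟨k, h⟩) = Hist.take (Nat.succ_le_of_lt h) y := by
  funext j
  refine Fin.lastCases ?_ (fun i => ?_) j
  · exact Fin.snoc_last (α := fun j : Fin (k + 1) => Y j) _ _
  · exact Fin.snoc_castSucc (α := fun j : Fin (k + 1) => Y j) _ _ i

variable {X Y : ℕ → Type*} [∀ i, MeasurableSpace (X i)] [∀ i, MeasurableSpace (Y i)]

theorem isMarkovKernel_causalProd {q : ∀ i, Kernel (Hist X (i + 1) × Hist Y i) (Y i)} {m : ℕ}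
    (hq : ∀ i < m, IsMarkovKernel (q i)) : IsMarkovKernel (causalProd q m) := by
  induction m with
  | zero => rw [causalProd]; infer_instance
  | succ m ih =>
    have := ih fun i hi => hq i (hi.trans m.lt_succ_self)
    have := hq m m.lt_succ_self
    rw [causalProd]
    exact Kernel.IsMarkovKernel.map _ Hist.measurable_append

/-- The later factors are Markov and integrate out to one, so the first `k` outputs see only the
first `k` inputs. -/
theorem map_take_causalProd {q : ∀ i, Kernel (Hist X (i + 1) × Hist Y i) (Y i)} {k m : ℕ}
    (hkm : k ≤ m) (hq : ∀ i < m, IsMarkovKernel (q i)) (x : Hist X m) :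
    (causalProd q m x).map (Hist.take hkm) = causalProd q k (Hist.take hkm x) := by
  induction m, hkm using Nat.le_induction with
  | base => exact Measure.map_id
  | succ m hkm ih =>
    have := isMarkovKernel_causalProd fun i hi => hq i (Nat.lt_succ_of_lt hi)
    have := hq m m.lt_succ_self
    have h1 : (Hist.take (hkm.trans m.le_succ) : Hist Y (m + 1) → Hist Y k) ∘ Hist.append
        = Hist.take hkm ∘ Prod.fst := funext fun p => Hist.take_append hkm p
    rw [causalProd, Kernel.map_apply _ Hist.measurable_append,
      Measure.map_map (Hist.measurable_take _) Hist.measurable_append, h1,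
      ← Measure.map_map (Hist.measurable_take _) measurable_fst]
    rw [← Kernel.fst_apply, Kernel.fst_compProd, Kernel.comap_apply,
      ih fun i hi => hq i (Nat.lt_succ_of_lt hi)]
    rfl

theorem map_prodMap_compProd_comap {A A' B : Type*} [MeasurableSpace A] [MeasurableSpace A']
    [MeasurableSpace B] (μ : Measure A) [IsFiniteMeasure μ] (κ : Kernel A' B) [IsFiniteKernel κ]
    {f : A → A'} (hf : Measurable f) :
    (μ ⊗ₘ κ.comap f hf).map (Prod.map f id) = (μ.map f) ⊗ₘ κ := by
  have hm : Measurable (Prod.map f (id : B → B)) := by fun_prop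
  refine Measure.ext fun s hs => ?_
  rw [Measure.map_apply hm hs, Measure.compProd_apply (hm hs), Measure.compProd_apply hs,
    lintegral_map (Kernel.measurable_kernel_prodMk_left hs) hf]
  rfl

variable {m : ℕ}

/-- The conditional law of the whole source given its first `k` entries. -/
noncomputable def futureKernel [∀ i, StandardBorelSpace (X i)] [Nonempty (Hist X m)]
    (μ : Measure (Hist X m)) [IsFiniteMeasure μ] {k : ℕ} (hk : k ≤ m) :
    Kernel (Hist X k) (Hist X m) :=
  condDistrib id (Hist.take hk) μ

variable [∀ i, StandardBorelSpace (X i)] [Nonempty (Hist X m)]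

instance (μ : Measure (Hist X m)) [IsFiniteMeasure μ] {k : ℕ} (hk : k ≤ m) :
    IsMarkovKernel (futureKernel μ hk) := by
  rw [futureKernel]; infer_instance

theorem measurable_futureKernel_take (μ : Measure (Hist X m)) [IsFiniteMeasure μ] {k : ℕ}
    (hk : k ≤ m) {s : Set (Hist X m)} (hs : MeasurableSet s) :
    Measurable fun x => futureKernel μ hk (Hist.take hk x) s :=
  (Kernel.measurable_coe _ hs).comp (Hist.measurable_take hk)

/-- The defining property of conditional probability, which exchanges the indicator of `s` for its
conditional probability against functions of the first `k` entries. -/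
theorem lintegral_futureKernel (μ : Measure (Hist X m)) [IsFiniteMeasure μ] {k : ℕ}
    (hk : k ≤ m) {s : Set (Hist X m)} (hs : MeasurableSet s) {h : Hist X k → ℝ≥0∞}
    (hh : Measurable h) :
    ∫⁻ x, futureKernel μ hk (Hist.take hk x) s * h (Hist.take hk x) ∂μ
      = ∫⁻ x, s.indicator 1 x * h (Hist.take hk x) ∂μ := by
  have ht := Hist.measurable_take (Z := X) hk
  have hi : Measurable (s.indicator (1 : Hist X m → ℝ≥0∞)) := measurable_one.indicator hs
  have hF : Measurable fun p : Hist X k × Hist X m => s.indicator (1 : Hist X m → ℝ≥0∞) p.2 * h p.1 :=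
    (hi.comp measurable_snd).mul (hh.comp measurable_fst)
  have key : (μ.map (Hist.take hk)) ⊗ₘ condDistrib id (Hist.take hk) μ
      = μ.map fun x => (Hist.take hk x, id x) := compProd_map_condDistrib aemeasurable_id
  have h1 : ∫⁻ p, s.indicator (1 : Hist X m → ℝ≥0∞) p.2 * h p.1
      ∂((μ.map (Hist.take hk)) ⊗ₘ condDistrib id (Hist.take hk) μ)
      = ∫⁻ x, s.indicator 1 x * h (Hist.take hk x) ∂μ := by
    rw [key, lintegral_map hF (by fun_prop)]
    rfl
  rw [← h1, Measure.lintegral_compProd hF, lintegral_map hF.lintegral_kernel_prod_right' ht]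
  refine lintegral_congr fun x => ?_
  dsimp only
  rw [lintegral_mul_const _ hi, lintegral_indicator_one hs]
  rfl

/-- A joint law is causal if, for every `k`, the first `k` outputs are conditionally independent of
the source given the first `k` source symbols. -/
def IsCausal (μ : Measure (Hist X m)) [IsFiniteMeasure μ] (ν : Measure (Hist X m × Hist Y m)) :
    Prop :=
  ∀ k (hk : k ≤ m) (s : Set (Hist X m)), MeasurableSet s →
    weightedLaw (s.indicator 1) (Hist.take hk) ν
      = weightedLaw (fun x => futureKernel μ hk (Hist.take hk x) s) (Hist.take hk) ν

theorem isCausal_compProd_causalProd (μ : Measure (Hist X m)) [IsFiniteMeasure μ]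
    {q : ∀ i, Kernel (Hist X (i + 1) × Hist Y i) (Y i)} (hq : ∀ i < m, IsMarkovKernel (q i)) :
    IsCausal μ (μ ⊗ₘ causalProd q m) := by
  intro k hk s hs
  have := isMarkovKernel_causalProd hq
  have ht := Hist.measurable_take (Z := Y) hk
  refine Measure.ext fun t ht' => ?_
  rw [weightedLaw_compProd_apply (measurable_one.indicator hs) ht _ _ ht',
    weightedLaw_compProd_apply (measurable_futureKernel_take μ hk hs) ht _ _ ht']
  simp_rw [← Measure.map_apply ht ht', map_take_causalProd hk hq]
  exact (lintegral_futureKernel μ hk hs (Kernel.measurable_coe _ ht')).symm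

/-- On a rectangle `s ×ˢ t`, causality replaces the indicator of `s` by a function of the first `k`
inputs; the known law of the `k`-prefixes then applies, and the conditional probability is turned
back into the indicator. -/
theorem IsCausal.map_prodMap_take {μ : Measure (Hist X m)} [IsFiniteMeasure μ]
    {ν : Measure (Hist X m × Hist Y m)} [IsFiniteMeasure ν] (hν : IsCausal μ ν) {k : ℕ}
    (hk : k ≤ m) {κ : Kernel (Hist X k) (Hist Y k)} [IsFiniteKernel κ]
    (h : ν.map (Prod.map (Hist.take hk) (Hist.take hk)) = (μ.map (Hist.take hk)) ⊗ₘ κ) :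
    ν.map (Prod.map id (Hist.take hk)) = μ ⊗ₘ κ.comap (Hist.take hk) (Hist.measurable_take hk) := by
  have htX := Hist.measurable_take (Z := X) hk
  have htY := Hist.measurable_take (Z := Y) hk
  refine Measure.ext_prod fun {s t} hs ht => ?_
  have hi : Measurable (t.indicator (1 : Hist Y k → ℝ≥0∞)) := measurable_one.indicator ht
  have hR := Kernel.measurable_coe (futureKernel μ hk) hs
  have hF : Measurable fun p : Hist X k × Hist Y k =>
      futureKernel μ hk p.1 s * t.indicator (1 : Hist Y k → ℝ≥0∞) p.2 :=
    (hR.comp measurable_fst).mul (hi.comp measurable_snd)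
  have h1 : ν.map (Prod.map id (Hist.take hk)) (s ×ˢ t)
      = weightedLaw (s.indicator 1) (Hist.take hk) ν t := by
    have hm : Measurable (Prod.map (id : Hist X m → Hist X m) (Hist.take (Z := Y) hk)) :=
      measurable_id.prodMap htY
    rw [weightedLaw_apply (measurable_one.indicator hs) htY _ ht, Measure.map_apply hm (hs.prod ht),
      ← lintegral_indicator_one (hm (hs.prod ht))]
    refine lintegral_congr fun p => ?_
    by_cases hp1 : p.1 ∈ s <;> by_cases hp2 : Hist.take hk p.2 ∈ t <;> simp [hp1, hp2]
  rw [h1, hν k hk s hs, weightedLaw_apply (measurable_futureKernel_take μ hk hs) htY _ ht,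
    Measure.compProd_apply_prod hs ht]
  calc ∫⁻ p, futureKernel μ hk (Hist.take hk p.1) s * t.indicator 1 (Hist.take hk p.2) ∂ν
      = ∫⁻ p, futureKernel μ hk p.1 s * t.indicator (1 : Hist Y k → ℝ≥0∞) p.2
          ∂(ν.map (Prod.map (Hist.take hk) (Hist.take hk))) :=
        (lintegral_map hF (htX.prodMap htY)).symm
    _ = ∫⁻ x, futureKernel μ hk (Hist.take hk x) s * κ (Hist.take hk x) t ∂μ := by
        rw [h, Measure.lintegral_compProd hF, lintegral_map hF.lintegral_kernel_prod_right' htX]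
        refine lintegral_congr fun x => ?_
        dsimp only
        rw [lintegral_const_mul _ hi, lintegral_indicator_one ht]
    _ = ∫⁻ x, s.indicator 1 x * κ (Hist.take hk x) t ∂μ :=
        lintegral_futureKernel μ hk hs (Kernel.measurable_coe _ ht)
    _ = ∫⁻ x in s, κ.comap (Hist.take hk) (Hist.measurable_take hk) x t ∂μ := by
        rw [← lintegral_indicator hs]
        refine lintegral_congr fun x => ?_
        by_cases hx : x ∈ s <;> simp [hx, Kernel.comap_apply]

variable [∀ i, StandardBorelSpace (Y i)]

/-- A causal joint law is given by a causal product. -/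
theorem IsCausal.exists_causalProd {μ : Measure (Hist X m)} [IsProbabilityMeasure μ]
    {ν : Measure (Hist X m × Hist Y m)} [IsProbabilityMeasure ν] (hν : IsCausal μ ν) :
    ∃ q : ∀ i, Kernel (Hist X (i + 1) × Hist Y i) (Y i),
      (∀ i < m, IsMarkovKernel (q i)) ∧ μ ⊗ₘ causalProd q m = ν := by
  have hne : ∀ i < m, Nonempty (Y i) := fun i hi =>
    ν.nonempty_of_neZero.map fun p => p.2 ⟨i, hi⟩
  have hmeas : ∀ i (hi : i < m), Measurable fun p : Hist X m × Hist Y m =>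
      (Hist.take (Nat.succ_le_of_lt hi) p.1, Hist.take hi.le p.2) := fun i hi =>
    ((Hist.measurable_take _).comp measurable_fst).prodMk
      ((Hist.measurable_take _).comp measurable_snd)
  have hY : ∀ i (hi : i < m), Measurable fun p : Hist X m × Hist Y m => (p.2 ⟨i, hi⟩ : Y i) :=
    fun i hi => (measurable_pi_apply (⟨i, hi⟩ : Fin m)).comp measurable_snd
  have hex : ∀ i, ∃ r : Kernel (Hist X (i + 1) × Hist Y i) (Y i), ∀ hi : i < m,
      IsMarkovKernel r ∧
      (ν.map fun p => (Hist.take (Nat.succ_le_of_lt hi) p.1, Hist.take hi.le p.2)) ⊗ₘ r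
        = ν.map fun p => ((Hist.take (Nat.succ_le_of_lt hi) p.1, Hist.take hi.le p.2),
          (p.2 ⟨i, hi⟩ : Y i)) := by
    intro i
    by_cases hi : i < m
    · have := hne i hi
      exact ⟨condDistrib (fun p => (p.2 ⟨i, hi⟩ : Y i))
        (fun p => (Hist.take (Nat.succ_le_of_lt hi) p.1, Hist.take hi.le p.2)) ν,
        fun _ => ⟨inferInstance, compProd_map_condDistrib (hY i hi).aemeasurable⟩⟩
    -- A default: factors of index at least `m` do not enter `causalProd q m`.
    · exact ⟨0, fun h => absurd h hi⟩
  choose q hq using hex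
  have hqM : ∀ i < m, IsMarkovKernel (q i) := fun i hi => (hq i hi).1
  refine ⟨q, hqM, ?_⟩
  have main : ∀ k (hk : k ≤ m), ν.map (Prod.map (Hist.take hk) (Hist.take hk))
      = (μ.map (Hist.take hk)) ⊗ₘ causalProd q k := by
    intro k
    induction k with
    -- Both sides are probability measures on a one-point space.
    | zero =>
      intro hk
      have := isMarkovKernel_causalProd (q := q) (m := 0) (by simp)
      have h1 : IsProbabilityMeasure (ν.map (Prod.map (Hist.take hk) (Hist.take hk))) :=
        Measure.isProbabilityMeasure_map
          ((Hist.measurable_take hk).prodMap (Hist.measurable_take hk)).aemeasurable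
      have h2 : IsProbabilityMeasure (μ.map (Hist.take hk)) :=
        Measure.isProbabilityMeasure_map (Hist.measurable_take hk).aemeasurable
      refine Measure.ext fun s _ => ?_
      rcases s.eq_empty_or_nonempty with rfl | hs
      · simp
      · rw [Subsingleton.eq_univ_of_nonempty hs, measure_univ, measure_univ]
    | succ k ih =>
      intro hk
      have hk' : k < m := hk
      have := isMarkovKernel_causalProd fun i (hi : i < k) => hqM i (hi.trans hk')
      have := hqM k hk'
      have htX := Hist.measurable_take (Z := X) hk
      have htY := Hist.measurable_take (Z := Y) hk'.le
      have htk := Hist.measurable_take (Z := X) k.le_succ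
      -- Causality enters here: revealing the next input `X_k` leaves the conditional law of the
      -- first `k` outputs unchanged. Attaching `Y_k` through `q k` is then the chain rule.
      have h1 := hν.map_prodMap_take hk'.le (ih hk'.le)
      have h2 : (ν.map fun p => (Hist.take hk p.1, Hist.take hk'.le p.2))
          = (μ.map (Hist.take hk)) ⊗ₘ (causalProd q k).comap (Hist.take k.le_succ) htk := by
        rw [← map_prodMap_compProd_comap μ _ htX]
        change _ = Measure.map _ (μ ⊗ₘ (causalProd q k).comap (Hist.take hk'.le) (Hist.measurable_take _))
        rw [← h1, Measure.map_map (htX.prodMap measurable_id) (measurable_id.prodMap htY)]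
        rfl
      have h3 := (hq k hk').2
      rw [h2] at h3
      have happ : Measurable fun z : Hist Y k × Y k => Hist.append z := Hist.measurable_append
      have h4 : Measurable fun p : Hist X m × Hist Y m =>
          ((Hist.take hk p.1, Hist.take hk'.le p.2), (p.2 ⟨k, hk'⟩ : Y k)) :=
        (hmeas k hk').prodMk (hY k hk')
      rw [causalProd, Measure.compProd_map happ, ← Measure.compProd_assoc', h3,
        Measure.map_map (MeasurableEquiv.measurable _) h4,
        Measure.map_map (measurable_id.prodMap happ) ((MeasurableEquiv.measurable _).comp h4)]
      congr 1
      funext p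
      exact Prod.ext rfl (Hist.append_take hk' p.2).symm
  have h := main m le_rfl
  have hidX : (Hist.take le_rfl : Hist X m → Hist X m) = id := rfl
  have hidY : (Hist.take le_rfl : Hist Y m → Hist Y m) = id := rfl
  rw [hidX, hidY, Prod.map_id, Measure.map_id, Measure.map_id] at h
  exact h.symm

end CausalProd

/-! ### Existence of an optimal kernel -/

variable {X Y : ℕ → Type*}
    [∀ i, TopologicalSpace (X i)] [∀ i, PolishSpace (X i)]
    [∀ i, MeasurableSpace (X i)] [∀ i, BorelSpace (X i)]
    [∀ i, TopologicalSpace (Y i)] [∀ i, PolishSpace (Y i)]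
    [∀ i, MeasurableSpace (Y i)] [∀ i, BorelSpace (Y i)]

theorem Hist.continuous_take {Z : ℕ → Type*} [∀ i, TopologicalSpace (Z i)] {k m : ℕ} (h : k ≤ m) :
    Continuous (Hist.take (Z := Z) h) :=
  continuous_pi fun j => continuous_apply (Fin.castLE h j)

theorem measurable_distortion {X Y : ℕ → Type*} [∀ i, MeasurableSpace (X i)]
    [∀ i, MeasurableSpace (Y i)] {ρ : ∀ i, Hist X (i + 1) → Hist Y (i + 1) → ℝ≥0∞} {n : ℕ}
    (hρ : ∀ i ≤ n, Measurable (Function.uncurry (ρ i))) :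
    Measurable (Function.uncurry (distortion ρ n)) := by
  have h : ∀ i : Fin (n + 1), Measurable fun p : Hist X (n + 1) × Hist Y (n + 1) =>
      ρ i (p.1.take i.isLt) (p.2.take i.isLt) := fun i =>
    (hρ i (Nat.le_of_lt_succ i.isLt)).comp (((Hist.measurable_take _).comp measurable_fst).prodMk
      ((Hist.measurable_take _).comp measurable_snd))
  exact Finset.measurable_sum Finset.univ fun i _ => h i

/-- The causal joint laws with source law `μ` form a compact set. -/
theorem isCompact_setOf_isCausal {m : ℕ} [CompactSpace (Hist Y m)] [Nonempty (Hist X m)]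
    (μ : Measure (Hist X m)) [IsProbabilityMeasure μ] :
    IsCompact {ν : ProbabilityMeasure (Hist X m × Hist Y m) |
      (ν : Measure (Hist X m × Hist Y m)).fst = μ ∧
        IsCausal μ (ν : Measure (Hist X m × Hist Y m))} := by
  let S : Set (ProbabilityMeasure (Hist X m × Hist Y m)) :=
    {ν | (ν : Measure (Hist X m × Hist Y m)).fst = μ}
  have hS : IsCompact S := isCompact_setOf_fst_eq μ
  refine hS.of_isClosed_subset ?_ fun ν hν => hν.1
  have heq : {ν : ProbabilityMeasure (Hist X m × Hist Y m) |
      (ν : Measure (Hist X m × Hist Y m)).fst = μ ∧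
        IsCausal μ (ν : Measure (Hist X m × Hist Y m))}
      = S ∩ ⋂ (k : ℕ) (hk : k ≤ m) (s : Set (Hist X m)) (_ : MeasurableSet s),
        {ν | (ν : Measure (Hist X m × Hist Y m)).fst = μ ∧
          weightedLaw (s.indicator 1) (Hist.take hk) (ν : Measure (Hist X m × Hist Y m))
          = weightedLaw (fun x => futureKernel μ hk (Hist.take hk x) s) (Hist.take hk)
            (ν : Measure (Hist X m × Hist Y m))} := by
    ext ν
    simp only [Set.mem_inter_iff, Set.mem_iInter]
    exact ⟨fun h => ⟨h.1, fun k hk s hs => ⟨h.1, h.2 k hk s hs⟩⟩,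
      fun h => ⟨h.1, fun k hk s hs => (h.2 k hk s hs).2⟩⟩
  rw [heq]
  refine hS.isClosed.inter (isClosed_iInter fun k => isClosed_iInter fun hk =>
    isClosed_iInter fun s => isClosed_iInter fun hs => ?_)
  exact isClosed_setOf_weightedLaw_eq μ (measurable_one.indicator hs)
    (fun x => Set.indicator_le_self' (fun _ _ => zero_le_one) x)
    (measurable_futureKernel_take μ hk hs) (fun x => prob_le_one) (Hist.continuous_take hk)

/-- This makes the objective a function of the joint law alone. -/
theorem mutualInfo_eq_klDiv_snd {A B : Type*} [MeasurableSpace A] [MeasurableSpace B]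
    (μ : Measure A) [SFinite μ] (κ : Kernel A B) [IsSFiniteKernel κ] :
    mutualInfo μ κ = klDiv (μ ⊗ₘ κ) (μ.prod (μ ⊗ₘ κ).snd) := by
  rw [mutualInfo, Measure.snd_compProd]

end CausalRD

theorem theorem1 {X Y : ℕ → Type*}
    [∀ i, TopologicalSpace (X i)] [∀ i, PolishSpace (X i)]
    [∀ i, MeasurableSpace (X i)] [∀ i, BorelSpace (X i)]
    [∀ i, TopologicalSpace (Y i)] [∀ i, PolishSpace (Y i)]
    [∀ i, MeasurableSpace (Y i)] [∀ i, BorelSpace (Y i)]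
    (n : ℕ) [CompactSpace (CausalRD.Hist Y (n + 1))]
    (μ : Measure (CausalRD.Hist X (n + 1))) [IsProbabilityMeasure μ]
    (ρ : ∀ i, CausalRD.Hist X (i + 1) → CausalRD.Hist Y (i + 1) → ℝ≥0∞)
    (hρ : ∀ i ≤ n, Measurable (Function.uncurry (ρ i)))
    (hd : ∀ x : CausalRD.Hist X (n + 1),
      Continuous fun y : CausalRD.Hist Y (n + 1) => CausalRD.distortion ρ n x y)
    (D : ℝ≥0) (hD : (CausalRD.fidelitySet μ ρ D).Nonempty) :
    ∃ κ ∈ CausalRD.fidelitySet μ ρ D,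
      CausalRD.mutualInfo μ κ = CausalRD.causalRDF μ ρ D := by
  open CausalRD in
  have hX : Nonempty (Hist X (n + 1)) := μ.nonempty_of_neZero
  let Ω := Hist X (n + 1) × Hist Y (n + 1)
  let C : Set (ProbabilityMeasure Ω) := {ν | (ν : Measure Ω).fst = μ ∧ IsCausal μ (ν : Measure Ω)}
  let cost : ProbabilityMeasure Ω → ℝ≥0∞ := fun ν => ∫⁻ p, distortion ρ n p.1 p.2 ∂(ν : Measure Ω)
  let K : Set (ProbabilityMeasure Ω) := C ∩ cost ⁻¹' Set.Iic (D : ℝ≥0∞)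
  have hlsc : LowerSemicontinuousOn cost C :=
    (lowerSemicontinuousOn_lintegral_of_caratheodory μ (measurable_distortion hρ) hd).mono
      fun ν hν => hν.1
  have hK : IsCompact K := hlsc.isCompact_inter_preimage_Iic (isCompact_setOf_isCausal μ) D
  have hmem : ∀ κ ∈ fidelitySet μ ρ D, ∃ ν ∈ K, (ν : Measure Ω) = μ ⊗ₘ κ := by
    rintro κ ⟨hcost, hκ, q, hq, hae⟩
    have hq' : ∀ i < n + 1, IsMarkovKernel (q i) := fun i hi => hq i (Nat.le_of_lt_succ hi)
    have := isMarkovKernel_causalProd hq'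
    refine ⟨⟨μ ⊗ₘ κ, inferInstance⟩, ⟨⟨Measure.fst_compProd μ κ, ?_⟩, hcost⟩, rfl⟩
    change IsCausal μ (μ ⊗ₘ κ)
    -- Almost everywhere equality suffices, since the joint law does not see `μ`-null sets of
    -- inputs.
    rw [Measure.compProd_congr hae]
    exact isCausal_compProd_causalProd μ hq'
  obtain ⟨κ₀, hκ₀⟩ := hD
  obtain ⟨ν₀, hν₀, -⟩ := hmem κ₀ hκ₀
  obtain ⟨ν, ⟨⟨hfst, hcausal⟩, hcost⟩, hmin⟩ := LowerSemicontinuousOn.exists_isMinOn ⟨ν₀, hν₀⟩ hK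
    ((lowerSemicontinuous_klDiv_prod_snd (B := Hist Y (n + 1)) μ).lowerSemicontinuousOn K)
  -- Disintegration turns the minimizing law back into a kernel, which is a causal product at every
  -- `x`, not only almost everywhere.
  obtain ⟨q, hq, hqν⟩ := hcausal.exists_causalProd
  have := isMarkovKernel_causalProd hq
  have hfid : causalProd q (n + 1) ∈ fidelitySet μ ρ D := by
    refine ⟨?_, inferInstance, q, fun i hi => hq i (Nat.lt_succ_of_le hi), ae_of_all _ fun _ => rfl⟩
    change ∫⁻ p, distortion ρ n p.1 p.2 ∂(μ ⊗ₘ causalProd q (n + 1)) ≤ D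
    rw [hqν]
    exact hcost
  refine ⟨causalProd q (n + 1), hfid, le_antisymm (le_iInf₂ fun κ hκ => ?_) (iInf₂_le _ hfid)⟩
  obtain ⟨ν', hν', hνκ⟩ := hmem κ hκ
  have := hκ.2.1
  rw [mutualInfo_eq_klDiv_snd, mutualInfo_eq_klDiv_snd, hqν, ← hνκ]
  exact hmin hν'
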